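/- Conventions. Compositions are written from left to right. A semigroup $S$ (possibly empty) is regular if for each $a\in S$ there is $x\in S$ with $axa=a$; $a\leqslant_r b$ means $a\in bS$, $\mathscr R$ is the induced equivalence, and $S/\mathscr R$ is partially ordered by $R_a\sqsubseteq R_b\iff a\leqslant_r b$. A category with subobjects is a small category $\mathcal C$ with a subcategory $\mathcal P$ having the same objects, whose morphisms are called inclusions, such that: $\mathcal P$ is a strict preorder (at most one morphism between any two objects, and only identities are isomorphisms); every inclusion is a monomorphism of $\mathcal C$; and if $f=hg$ with $f,g\in\mathcal P$ and $h\in\mathcal C$, then $h\in\mathcal P$. A retraction is a morphism $q$ with $jq=1$ for some inclusion $j$. A cone with vertex $z$ is a family of morphisms $\gamma(c)\colon c\to z$, one for each object $c$, with $j\,\gamma(b)=\gamma(a)$ for every inclusion $j\colon a\to b$, and with at least one component an isomorphism. $\mathcal C$ is a normal category if every inclusion $j$ has some $q$ with $jq=1$, every morphism is of the form $quj$ with $q$ a retraction, $u$ an isomorphism and $j$ an inclusion, and for every object $c$ there is a cone $\mu$ with vertex $c$ and $\mu(c)=1_c$. In a normal category the morphism $f^\circ:=qu$ depends only on $f=quj$,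 and the set $\widehat{\mathcal C}$ of all cones is a regular semigroup under $(\gamma\cdot\delta)(c)=\gamma(c)\,(\delta(z_\gamma))^\circ$, where $z_\gamma$ is the vertex of $\gamma$. An object $c$ is connected by $\mathfrak d\in\widehat{\mathcal C}/\mathscr R$ if $\mathfrak d$ contains an idempotent cone with vertex $c$; this cone is then unique and is denoted by $\epsilon(c,\mathfrak d)$. A CC-morphism from a normal category $\mathcal C$ to a normal category $\mathcal C'$ is a pair $(F,G)$, where $F\colon\mathcal C\to\mathcal C'$ is an inclusion-preserving functor and $G\colon\widehat{\mathcal C}/\mathscr R\to\widehat{\mathcal C'}/\mathscr R$ is an order-preserving map, such that whenever $c$ is connected by $\mathfrak d$, $F(c)$ is connected by $G(\mathfrak d)$ and $F(\epsilon(c,\mathfrak d)(c'))=\epsilon(F(c),G(\mathfrak d))(F(c'))$ for every object $c'$ of $\mathcal C$. For a regular semigroup $S$, let $\mathbb L(S)$ be the category whose objects are the left ideals $Se$ ($e\in S$ idempotent) and whose morphisms from $Se$ to $Sf$ are the maps $x\mapsto xu$ with $u\in eSf$; with the set inclusions as inclusions it is a normal category. $S$ is totally left reductive if it is regular and isomorphic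 to the semigroup $\widehat{\mathbb L(S)}$ of all cones in $\mathbb L(S)$. Theorem. The category of normal categories, with CC-morphisms, is equivalent to the category of totally left reductive semigroups, with semigroup homomorphisms. -/

import Mathlib

open CategoryTheory

universe u

namespace ConnCat

/-! ### Regular semigroups, the right quasi-order and R-classes -/

/-- A semigroup is (von Neumann) regular if every `a` has some `x` with `a x a = a`. -/
class RegularSemigroup (S : Type u) [Semigroup S] : Prop where
  regular : ∀ a : S, ∃ x : S, a * x * a = a

/-- The quasi-order `a ≤_r b ↔ a ∈ bS`. -/
def RightLE {S : Type u} [Semigroup S] (a b : S) : Prop := ∃ x : S, a = b * x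

theorem RightLE.refl {S : Type u} [Semigroup S] [RegularSemigroup S] (a : S) : RightLE a a := by
  obtain ⟨x, hx⟩ := RegularSemigroup.regular a
  exact ⟨x * a, by rw [← mul_assoc, hx]⟩

theorem RightLE.trans {S : Type u} [Semigroup S] {a b c : S} (h : RightLE a b)
    (h' : RightLE b c) : RightLE a c := by
  obtain ⟨x, rfl⟩ := h
  obtain ⟨y, rfl⟩ := h'
  exact ⟨y * x, mul_assoc _ _ _⟩

/-- Green's relation R on a regular semigroup. -/
def greenR (S : Type u) [Semigroup S] [RegularSemigroup S] : Setoid S where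
  r a b := RightLE a b ∧ RightLE b a
  iseqv :=
    { refl := fun a => ⟨RightLE.refl a, RightLE.refl a⟩
      symm := fun h => ⟨h.2, h.1⟩
      trans := fun h k => ⟨h.1.trans k.1, k.2.trans h.2⟩ }

/-- The set `S/R` of R-classes of a regular semigroup. -/
def RClass (S : Type u) [Semigroup S] [RegularSemigroup S] : Type u := Quotient (greenR S)

/-- The R-class of an element. -/
def rClass {S : Type u} [Semigroup S] [RegularSemigroup S] (a : S) : RClass S :=
  Quotient.mk (greenR S) a

/-- The partial order `R_a ⊑ R_b ↔ a ≤_r b` on `S/R`. -/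
instance (S : Type u) [Semigroup S] [RegularSemigroup S] : PartialOrder (RClass S) where
  le := Quotient.lift₂ (fun a b : S => RightLE a b) (fun _ _ _ _ h k =>
    propext ⟨fun t => (h.2.trans t).trans k.1, fun t => (h.1.trans t).trans k.2⟩)
  le_refl := by
    rintro ⟨a⟩
    exact RightLE.refl a
  le_trans := by
    rintro ⟨a⟩ ⟨b⟩ ⟨c⟩ h k
    exact RightLE.trans h k
  le_antisymm := by
    rintro ⟨a⟩ ⟨b⟩ h k
    exact Quotient.sound ⟨h, k⟩

/-! ### Categories with subobjects and normal categories -/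

/-- A small category with a distinguished wide subcategory (its morphisms are the inclusions)
that is a strict preorder, such that inclusions are monomorphisms and `h ≫ g = f` with `f`, `g`
inclusions forces `h` to be an inclusion. -/
class CategoryWithSubobjects (C : Type u) [SmallCategory C] where
  incl : MorphismProperty C
  incl_id : ∀ a : C, incl (𝟙 a)
  incl_comp : ∀ {a b c : C} (f : a ⟶ b) (g : b ⟶ c), incl f → incl g → incl (f ≫ g)
  incl_unique : ∀ {a b : C} (f g : a ⟶ b), incl f → incl g → f = g
  incl_antisymm : ∀ {a b : C} (f : a ⟶ b) (g : b ⟶ a), incl f → incl g → a = b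
  incl_mono : ∀ {a b : C} (f : a ⟶ b), incl f → Mono f
  incl_of_comp : ∀ {a b c : C} (h : a ⟶ b) (g : b ⟶ c), incl g → incl (h ≫ g) → incl h

open CategoryWithSubobjects

section

variable {C : Type u} [SmallCategory C] [CategoryWithSubobjects C]

/-- A retraction: a right inverse (in the order of composition) of an inclusion. -/
def IsRetraction {b a : C} (q : b ⟶ a) : Prop := ∃ j : a ⟶ b, incl j ∧ j ≫ q = 𝟙 a

variable (C) in
/-- A cone with vertex `z`. -/
@[ext]
structure ConeAt (z : C) where
  app : ∀ c : C, c ⟶ z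
  incl_app : ∀ {a b : C} (j : a ⟶ b), incl j → j ≫ app b = app a
  exists_isIso : ∃ c : C, IsIso (app c)

variable (C) in
/-- The set of all cones in `C`, with arbitrary vertices. -/
structure Cones where
  vertex : C
  cone : ConeAt C vertex

end

/-- A normal category. -/
class NormalCategory (C : Type u) [SmallCategory C] extends CategoryWithSubobjects C where
  incl_splits : ∀ {a b : C} (j : a ⟶ b), incl j → ∃ q : b ⟶ a, j ≫ q = 𝟙 a
  normal_factorisation : ∀ {a b : C} (f : a ⟶ b), ∃ (a' b' : C) (q : a ⟶ a') (v : a' ⟶ b')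
    (j : b' ⟶ b), IsRetraction q ∧ IsIso v ∧ incl j ∧ f = q ≫ v ≫ j
  exists_cone : ∀ c : C, ∃ μ : ConeAt C c, μ.app c = 𝟙 c

/-! ### The semigroup of cones -/

section

variable {C : Type u} [SmallCategory C] [NormalCategory C]

/-- A composite of a retraction followed by an isomorphism. -/
def IsNormalEpi {a b : C} (p : a ⟶ b) : Prop :=
  ∃ (a' : C) (q : a ⟶ a') (v : a' ⟶ b), IsRetraction q ∧ IsIso v ∧ p = q ≫ v

theorem IsNormalEpi.exists_section {a b : C} {p : a ⟶ b} (h : IsNormalEpi p) :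
    ∃ i : b ⟶ a, i ≫ p = 𝟙 b := by
  obtain ⟨a', q, v, ⟨j, -, hj⟩, hv, rfl⟩ := h
  exact ⟨inv v ≫ j, by simp [reassoc_of% hj]⟩

theorem IsNormalEpi.epi {a b : C} {p : a ⟶ b} (h : IsNormalEpi p) : Epi p := by
  obtain ⟨i, hi⟩ := h.exists_section
  have : IsSplitEpi p := ⟨⟨⟨i, hi⟩⟩⟩
  infer_instance

theorem IsNormalEpi.of_isIso {a b : C} (p : a ⟶ b) [IsIso p] : IsNormalEpi p :=
  ⟨a, 𝟙 a, p, ⟨𝟙 a, incl_id a, by simp⟩, inferInstance, by simp⟩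

theorem IsNormalEpi.of_epi {a b : C} (p : a ⟶ b) [Epi p] : IsNormalEpi p := by
  obtain ⟨a', b', q, v, j, hq, hv, hj, rfl⟩ := NormalCategory.normal_factorisation p
  have hm : Mono j := incl_mono j hj
  have he : Epi j := by
    have : Epi ((q ≫ v) ≫ j) := by simpa using (inferInstance : Epi (q ≫ v ≫ j))
    exact epi_of_epi (q ≫ v) j
  obtain ⟨r, hr⟩ := NormalCategory.incl_splits j hj
  have : IsSplitMono j := ⟨⟨⟨r, hr⟩⟩⟩
  have : IsIso j := isIso_of_epi_of_isSplitMono j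
  exact ⟨a', q, v ≫ j, hq, inferInstance, rfl⟩

theorem IsNormalEpi.comp {a b c : C} {p : a ⟶ b} {q : b ⟶ c} (hp : IsNormalEpi p)
    (hq : IsNormalEpi q) : IsNormalEpi (p ≫ q) := by
  have := hp.epi
  have := hq.epi
  have : Epi (p ≫ q) := epi_comp p q
  exact IsNormalEpi.of_epi _

/-- The factorisation `f = p ≫ j` is canonical: `p` is a retraction followed by an isomorphism
and `j` is an inclusion. -/
def IsCanonical {a b z : C} (f : a ⟶ b) (p : a ⟶ z) (j : z ⟶ b) : Prop :=
  IsNormalEpi p ∧ incl j ∧ f = p ≫ j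

theorem exists_canonical {a b : C} (f : a ⟶ b) :
    ∃ (z : C) (p : a ⟶ z) (j : z ⟶ b), IsCanonical f p j := by
  obtain ⟨a', b', q, v, j, hq, hv, hj, rfl⟩ := NormalCategory.normal_factorisation f
  exact ⟨b', q ≫ v, j, ⟨a', q, v, hq, hv, rfl⟩, hj, by simp⟩

theorem canonical_unique {a b z z' : C} {f : a ⟶ b} {p : a ⟶ z} {j : z ⟶ b} {p' : a ⟶ z'}
    {j' : z' ⟶ b} (h : IsCanonical f p j) (h' : IsCanonical f p' j') :
    z = z' ∧ HEq p p' := by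
  obtain ⟨hp, hj, rfl⟩ := h
  obtain ⟨hp', hj', e⟩ := h'
  obtain ⟨i, hi⟩ := hp.exists_section
  obtain ⟨i', hi'⟩ := hp'.exists_section
  have e1 : (i ≫ p') ≫ j' = j := by
    rw [Category.assoc, ← e, reassoc_of% hi]
  have e2 : (i' ≫ p) ≫ j = j' := by
    rw [Category.assoc, e, reassoc_of% hi']
  have k1 : incl (i ≫ p') := incl_of_comp _ j' hj' (by rw [e1]; exact hj)
  have k2 : incl (i' ≫ p) := incl_of_comp _ j hj (by rw [e2]; exact hj')
  obtain rfl := incl_antisymm _ _ k1 k2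
  obtain rfl := incl_unique j j' hj hj'
  have := incl_mono j hj
  exact ⟨rfl, heq_of_eq ((cancel_mono j).1 e)⟩

/-- The image of a morphism. -/
noncomputable def im {a b : C} (f : a ⟶ b) : C := (exists_canonical f).choose

/-- The epimorphic component of a morphism. -/
noncomputable def epiPart {a b : C} (f : a ⟶ b) : a ⟶ im f :=
  (exists_canonical f).choose_spec.choose

/-- The inclusion of a morphism. -/
noncomputable def inclPart {a b : C} (f : a ⟶ b) : im f ⟶ b :=
  (exists_canonical f).choose_spec.choose_spec.choose

theorem isCanonical {a b : C} (f : a ⟶ b) : IsCanonical f (epiPart f) (inclPart f) :=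
  (exists_canonical f).choose_spec.choose_spec.choose_spec

/-- The cone `γ ∗ p`, with components `γ(c) p`. -/
def ConeAt.star {z z' : C} (γ : ConeAt C z) (p : z ⟶ z') (hp : IsNormalEpi p) :
    ConeAt C z' where
  app c := γ.app c ≫ p
  incl_app j hj := by rw [← Category.assoc, γ.incl_app j hj]
  exists_isIso := by
    obtain ⟨c, hc⟩ := γ.exists_isIso
    obtain ⟨i, hi⟩ := hp.exists_section
    obtain ⟨a', b', q, v, j, ⟨k, hk, hkq⟩, hv, hj, e⟩ :=
      NormalCategory.normal_factorisation (i ≫ inv (γ.app c))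
    have e1 : q ≫ v ≫ j ≫ γ.app c ≫ p = 𝟙 z' := by
      have := congrArg (fun t => t ≫ γ.app c ≫ p) e
      simpa [hi] using this.symm
    have hq : IsIso q := by
      have : IsSplitMono q := ⟨⟨⟨v ≫ j ≫ γ.app c ≫ p, by simpa using e1⟩⟩⟩
      have : IsSplitEpi q := ⟨⟨⟨k, hkq⟩⟩⟩
      have : Epi q := inferInstance
      exact isIso_of_epi_of_isSplitMono q
    refine ⟨b', ?_⟩
    have e2 : γ.app b' ≫ p = inv v ≫ inv q := by
      rw [← γ.incl_app j hj, IsIso.eq_inv_comp, ← cancel_epi q, IsIso.hom_inv_id]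
      simpa using e1
    rw [e2]
    infer_instance

/-- The product of cones `γ · δ = γ ∗ (δ(z_γ))°`. -/
noncomputable instance : Mul (Cones C) where
  mul γ δ := ⟨im (δ.cone.app γ.vertex),
    γ.cone.star (epiPart (δ.cone.app γ.vertex)) (isCanonical _).1⟩

theorem star_congr {x z z' : C} (γ : ConeAt C x) {p : x ⟶ z} {p' : x ⟶ z'}
    (hp : IsNormalEpi p) (hp' : IsNormalEpi p') (h : z = z' ∧ HEq p p') :
    (⟨z, γ.star p hp⟩ : Cones C) = ⟨z', γ.star p' hp'⟩ := by
  obtain ⟨rfl, h⟩ := h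
  obtain rfl := eq_of_heq h
  rfl

/-- The product may be computed from any canonical factorisation. -/
theorem mul_eq {x y z : C} (γ : ConeAt C x) (δ : ConeAt C y) {p : x ⟶ z} {j : z ⟶ y}
    (h : IsCanonical (δ.app x) p j) :
    (⟨x, γ⟩ * ⟨y, δ⟩ : Cones C) = ⟨z, γ.star p h.1⟩ :=
  star_congr γ _ _ (canonical_unique (isCanonical _) h)

theorem star_star {x y z : C} (γ : ConeAt C x) (p : x ⟶ y) (q : y ⟶ z) (hp : IsNormalEpi p)
    (hq : IsNormalEpi q) : (γ.star p hp).star q hq = γ.star (p ≫ q) (hp.comp hq) := by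
  ext c
  simp [ConeAt.star]

noncomputable instance : Semigroup (Cones C) where
  mul_assoc := by
    rintro ⟨x, γ⟩ ⟨y, δ⟩ ⟨z, η⟩
    obtain ⟨z₁, p₁, j₁, h₁⟩ := exists_canonical (δ.app x)
    obtain ⟨z₂, p₂, j₂, h₂⟩ := exists_canonical (η.app y)
    obtain ⟨z₃, p₃, j₃, h₃⟩ := exists_canonical (j₁ ≫ p₂)
    rw [mul_eq γ δ h₁, mul_eq δ η h₂]
    have k₁ : IsCanonical (η.app z₁) p₃ (j₃ ≫ j₂) := by
      refine ⟨h₃.1, incl_comp _ _ h₃.2.1 h₂.2.1, ?_⟩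
      rw [← η.incl_app j₁ h₁.2.1, h₂.2.2, ← Category.assoc, h₃.2.2, Category.assoc]
    have k₂ : IsCanonical ((δ.star p₂ h₂.1).app x) (p₁ ≫ p₃) j₃ := by
      refine ⟨h₁.1.comp h₃.1, h₃.2.1, ?_⟩
      change δ.app x ≫ p₂ = _
      rw [h₁.2.2, Category.assoc, h₃.2.2, Category.assoc]
    rw [mul_eq _ _ k₁, mul_eq _ _ k₂, star_star]

theorem isCanonical_of_isIso {a b : C} (f : a ⟶ b) [IsIso f] : IsCanonical f f (𝟙 b) :=
  ⟨IsNormalEpi.of_isIso f, incl_id b, by simp⟩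

instance : RegularSemigroup (Cones C) where
  regular := by
    rintro ⟨z, γ⟩
    obtain ⟨d, hd⟩ := γ.exists_isIso
    obtain ⟨μ, hμ⟩ := NormalCategory.exists_cone z
    have hi : IsCanonical ((μ.star (inv (γ.app d)) (IsNormalEpi.of_isIso _)).app z)
        (inv (γ.app d)) (𝟙 d) := by
      have : (μ.star (inv (γ.app d)) (IsNormalEpi.of_isIso _)).app z = inv (γ.app d) := by
        simp [ConeAt.star, hμ]
      rw [this]
      exact isCanonical_of_isIso _
    refine ⟨⟨d, μ.star (inv (γ.app d)) (IsNormalEpi.of_isIso _)⟩, ?_⟩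
    rw [mul_eq _ _ hi, mul_eq _ _ (isCanonical_of_isIso (γ.app d)), star_star]
    congr 1
    ext c
    simp [ConeAt.star]

/-- A cone is idempotent if and only if its component at its vertex is the identity. -/
theorem isIdempotentElem_iff {z : C} (μ : ConeAt C z) :
    IsIdempotentElem (⟨z, μ⟩ : Cones C) ↔ μ.app z = 𝟙 z := by
  constructor
  · intro h
    obtain ⟨w, p, j, hc⟩ := exists_canonical (μ.app z)
    rw [IsIdempotentElem, mul_eq _ _ hc] at h
    obtain ⟨c, hi⟩ := μ.exists_isIso
    injection h with h1 h2
    subst h1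
    have h3 := congrFun (congrArg ConeAt.app (eq_of_heq h2)) c
    have hp : p = 𝟙 _ := (cancel_epi (μ.app c)).1 (by simpa [ConeAt.star] using h3)
    rw [hc.2.2, hp, incl_unique j (𝟙 _) hc.2.1 (incl_id _), Category.comp_id]
  · intro h
    have hc : IsCanonical (μ.app z) (𝟙 z) (𝟙 z) := by
      rw [h]
      exact isCanonical_of_isIso (𝟙 z)
    rw [IsIdempotentElem, mul_eq _ _ hc]
    congr 1
    ext c
    simp [ConeAt.star]

/-- An idempotent cone is determined by its vertex and its R-class. -/
theorem idempotent_unique {z : C} (μ ν : ConeAt C z) (hμ : IsIdempotentElem (⟨z, μ⟩ : Cones C))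
    (hν : IsIdempotentElem (⟨z, ν⟩ : Cones C))
    (h : rClass (⟨z, μ⟩ : Cones C) = rClass ⟨z, ν⟩) : μ = ν := by
  obtain ⟨x, hx⟩ : RightLE (⟨z, ν⟩ : Cones C) ⟨z, μ⟩ := (Quotient.exact h).2
  have e : (⟨z, μ⟩ * ⟨z, ν⟩ : Cones C) = ⟨z, ν⟩ := by
    rw [hx, ← mul_assoc, hμ]
  have hc : IsCanonical (ν.app z) (𝟙 z) (𝟙 z) := by
    rw [(isIdempotentElem_iff ν).1 hν]
    exact isCanonical_of_isIso (𝟙 z)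
  rw [mul_eq _ _ hc] at e
  injection e with _ e
  rw [← e]
  ext c
  simp [ConeAt.star]

end

/-! ### Connected categories and CC-morphisms -/

/-- The object `c` is connected by the R-class `d`: some idempotent cone with vertex `c`
belongs to `d`. -/
def IsConnectedBy {C : Type u} [SmallCategory C] [NormalCategory C] (c : C)
    (d : RClass (Cones C)) : Prop :=
  ∃ ε : ConeAt C c, IsIdempotentElem (⟨c, ε⟩ : Cones C) ∧ rClass (⟨c, ε⟩ : Cones C) = d

/-- The (unique) idempotent cone `ε(c, d)` with vertex `c` in the R-class `d`. -/
noncomputable def IsConnectedBy.cone {C : Type u} [SmallCategory C] [NormalCategory C] {c : C}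
    {d : RClass (Cones C)} (h : IsConnectedBy c d) : ConeAt C c :=
  h.choose

/-- A connected category: a normal category with a down-set of the poset of R-classes of its
semigroup of cones that connects every object. -/
structure ConnectedCategory : Type (u + 1) where
  carrier : Type u
  [cat : SmallCategory carrier]
  [normal : NormalCategory carrier]
  downSet : LowerSet (RClass (Cones carrier))
  connects : ∀ c : carrier, ∃ d ∈ downSet, IsConnectedBy c d

attribute [instance] ConnectedCategory.cat ConnectedCategory.normal

/-- A CC-morphism `(F, G)`: an inclusion preserving functor `F` and an order preserving map `G`
of the connecting down-sets such that, whenever `c` is connected by `d`, `F(c)` is connected by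
`G(d)` and `F(ε(c, d)(c')) = ε(F(c), G(d))(F(c'))` for every object `c'`. -/
@[ext]
structure CCMorphism (X Y : ConnectedCategory.{u}) where
  functor : X.carrier ⥤ Y.carrier
  map : X.downSet →o Y.downSet
  map_incl : ∀ {a b : X.carrier} (j : a ⟶ b), incl j → incl (functor.map j)
  connected : ∀ (c : X.carrier) (d : X.downSet), IsConnectedBy c d.1 →
    IsConnectedBy (functor.obj c) (map d).1
  map_cone : ∀ (c : X.carrier) (d : X.downSet) (h : IsConnectedBy c d.1) (c' : X.carrier),
    functor.map (h.cone.app c') = (connected c d h).cone.app (functor.obj c')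

/-- The category of connected categories and CC-morphisms. -/
noncomputable instance : Category ConnectedCategory.{u} where
  Hom := CCMorphism
  id X :=
    { functor := 𝟭 X.carrier
      map := OrderHom.id
      map_incl := fun _ h => h
      connected := fun _ _ h => h
      map_cone := fun _ _ _ _ => rfl }
  comp {X Y Z} f g :=
    { functor := f.functor ⋙ g.functor
      map := g.map.comp f.map
      map_incl := fun j h => g.map_incl _ (f.map_incl j h)
      connected := fun c d h => g.connected _ _ (f.connected c d h)
      map_cone := fun c d h c' => by
        change g.functor.map (f.functor.map (h.cone.app c')) = _
        rw [f.map_cone c d h c']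
        exact g.map_cone _ _ (f.connected c d h) _ }
  id_comp _ := rfl
  comp_id _ := rfl
  assoc _ _ _ := rfl

/-- A bundled normal category. -/
structure NormalCat : Type (u + 1) where
  carrier : Type u
  [cat : SmallCategory carrier]
  [normal : NormalCategory carrier]

attribute [instance] NormalCat.cat NormalCat.normal

/-- A normal category, viewed as a connected category through the set of all R-classes of its
semigroup of cones. -/
noncomputable def NormalCat.toConnected (C : NormalCat.{u}) : ConnectedCategory.{u} where
  carrier := C.carrier
  downSet := ⊤
  connects c := by
    obtain ⟨μ, hμ⟩ := NormalCategory.exists_cone c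
    exact ⟨_, trivial, μ, (isIdempotentElem_iff μ).2 hμ, rfl⟩

/-- The category of normal categories with CC-morphisms. -/
noncomputable instance : Category NormalCat.{u} where
  Hom C D := C.toConnected ⟶ D.toConnected
  id C := 𝟙 C.toConnected
  comp f g := f ≫ g
  id_comp f := Category.id_comp (X := NormalCat.toConnected _) f
  comp_id f := Category.comp_id (Y := NormalCat.toConnected _) f
  assoc f g h := Category.assoc (W := NormalCat.toConnected _) f g h

/-! ### The category of principal left ideals of a regular semigroup -/

/-- The principal left ideal `Se`. -/
def leftIdeal {S : Type u} [Semigroup S] (e : S) : Set S := {x | ∃ y : S, x = y * e}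

/-- The objects of `L(S)`: the left ideals `Se` with `e` idempotent. -/
@[ext]
structure LeftCat (S : Type u) [Semigroup S] where
  ideal : Set S
  exists_idempotent : ∃ e : S, IsIdempotentElem e ∧ ideal = leftIdeal e

section

variable {S : Type u} [Semigroup S]

/-- A map from `Se` to `Sf` is of the form `r(e, v, f) : x ↦ x v` with `v ∈ eSf`. -/
def IsRightTranslation {A B : LeftCat S} (φ : A.ideal → B.ideal) : Prop :=
  ∃ e f v : S, IsIdempotentElem e ∧ IsIdempotentElem f ∧ A.ideal = leftIdeal e ∧
    B.ideal = leftIdeal f ∧ (∃ s : S, v = e * s * f) ∧ ∀ x : A.ideal, (φ x : S) = x * v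

theorem mul_of_mem_leftIdeal {e x : S} (he : IsIdempotentElem e) (hx : x ∈ leftIdeal e) :
    x * e = x := by
  obtain ⟨y, rfl⟩ := hx
  rw [mul_assoc, he]

theorem mem_leftIdeal {e : S} (he : IsIdempotentElem e) : e ∈ leftIdeal e := ⟨e, he.symm⟩

/-- The category `L(S)`. -/
instance : SmallCategory (LeftCat S) where
  Hom A B := {φ : A.ideal → B.ideal // IsRightTranslation φ}
  id A := ⟨id, by
    obtain ⟨e, he, hA⟩ := A.exists_idempotent
    refine ⟨e, e, e, he, he, hA, hA, ⟨e, by rw [he, he]⟩, fun x => ?_⟩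
    exact (mul_of_mem_leftIdeal he (hA ▸ x.2)).symm⟩
  comp {A B D} φ ψ := ⟨ψ.1 ∘ φ.1, by
    obtain ⟨e, f, v, he, hf, hA, hB, ⟨s, hs⟩, hφ⟩ := φ.2
    obtain ⟨g, h, w, hg, hh, hB', hD, ⟨t, ht⟩, hψ⟩ := ψ.2
    refine ⟨e, h, v * w, he, hh, hA, hD, ⟨s * f * (g * t), ?_⟩, fun x => ?_⟩
    · rw [hs, ht]; simp only [mul_assoc]
    · rw [Function.comp_apply, hψ, hφ, mul_assoc]⟩

theorem LeftCat.hom_ext {A B : LeftCat S} {φ ψ : A ⟶ B}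
    (h : ∀ x : A.ideal, (φ.1 x : S) = ψ.1 x) : φ = ψ :=
  Subtype.ext (funext fun x => Subtype.ext (h x))

theorem LeftCat.comp_val {A B D : LeftCat S} (φ : A ⟶ B) (ψ : B ⟶ D) (x : A.ideal) :
    (φ ≫ ψ).1 x = ψ.1 (φ.1 x) := rfl

theorem LeftCat.id_val {A : LeftCat S} (x : A.ideal) : (𝟙 A : A ⟶ A).1 x = x := rfl

/-- The inclusions of `L(S)` are the set inclusions `r(e, e, f)` of left ideals. -/
instance : CategoryWithSubobjects (LeftCat S) where
  incl A B φ := ∀ x : A.ideal, (φ.1 x : S) = x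
  incl_id _ _ := rfl
  incl_comp f g hf hg x := by rw [LeftCat.comp_val, hg, hf]
  incl_unique f g hf hg := LeftCat.hom_ext fun x => by rw [hf, hg]
  incl_antisymm {A B} f g hf hg := by
    ext x
    refine ⟨fun hx => ?_, fun hx => ?_⟩
    · have h := (f.1 ⟨x, hx⟩).2
      rwa [hf] at h
    · have h := (g.1 ⟨x, hx⟩).2
      rwa [hg] at h
  incl_mono {A B} f hf := ⟨fun {Z} g h e => LeftCat.hom_ext fun x => by
    have := congrArg (fun k : Z ⟶ B => (k.1 x : S)) e
    simpa only [LeftCat.comp_val, hf] using this⟩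
  incl_of_comp h g hg hgh x := by rw [← hg, ← LeftCat.comp_val, hgh]

/-- The object `Se`. -/
def LeftCat.of (e : S) (he : IsIdempotentElem e) : LeftCat S := ⟨leftIdeal e, e, he, rfl⟩

theorem LeftCat.of_ideal (e : S) (he : IsIdempotentElem e) :
    (LeftCat.of e he).ideal = leftIdeal e := rfl

/-- The morphism `r(e, v, f) : x ↦ x v`, for `v ∈ eSf`. -/
def LeftCat.r {A B : LeftCat S} (e v f : S) (he : IsIdempotentElem e) (hf : IsIdempotentElem f)
    (hA : A.ideal = leftIdeal e) (hB : B.ideal = leftIdeal f) (hev : e * v = v)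
    (hvf : v * f = v) : A ⟶ B :=
  ⟨fun x => ⟨x * v, hB ▸ ⟨x * v, by rw [mul_assoc, hvf]⟩⟩,
    e, f, v, he, hf, hA, hB, ⟨v, by rw [hev, hvf]⟩, fun _ => rfl⟩

theorem LeftCat.r_val {A B : LeftCat S} (e v f : S) (he : IsIdempotentElem e)
    (hf : IsIdempotentElem f) (hA : A.ideal = leftIdeal e) (hB : B.ideal = leftIdeal f)
    (hev : e * v = v) (hvf : v * f = v) (x : A.ideal) :
    ((LeftCat.r e v f he hf hA hB hev hvf).1 x : S) = x * v := rfl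

end

/-- If `S` is a regular semigroup, then `L(S)` is a normal category. -/
instance {S : Type u} [Semigroup S] [RegularSemigroup S] : NormalCategory (LeftCat S) where
  incl_splits {A B} j hj := by
    obtain ⟨e, he, hA⟩ := A.exists_idempotent
    obtain ⟨f, hf, hB⟩ := B.exists_idempotent
    have hef : e * f = e := by
      have h1 : e ∈ A.ideal := hA ▸ mem_leftIdeal he
      have h2 := (j.1 ⟨e, h1⟩).2
      rw [hj, hB] at h2
      exact mul_of_mem_leftIdeal hf h2
    refine ⟨LeftCat.r f (f * e) e hf he hB hA (by rw [← mul_assoc, hf])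
      (by rw [mul_assoc, he]), LeftCat.hom_ext fun x => ?_⟩
    have hx : (x : S) * e = x := mul_of_mem_leftIdeal he (hA ▸ x.2)
    have hxf : (x : S) * f = x := by rw [← hx, mul_assoc, hef]
    rw [LeftCat.comp_val, LeftCat.r_val, hj, LeftCat.id_val, ← mul_assoc, hxf, hx]
  normal_factorisation {A B} φ := by
    obtain ⟨e, f, v, he, hf, hA, hB, ⟨s, hs⟩, hφ⟩ := φ.2
    have hev : e * v = v := by rw [hs, ← mul_assoc, ← mul_assoc, he]
    have hvf : v * f = v := by rw [hs, mul_assoc, hf]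
    obtain ⟨x, hx⟩ := RegularSemigroup.regular v
    have hxv : IsIdempotentElem (x * v) := by
      rw [IsIdempotentElem, mul_assoc, ← mul_assoc v, hx]
    have hg : IsIdempotentElem (v * x * e) := by
      rw [IsIdempotentElem, mul_assoc (v * x) e, mul_assoc v x e, ← mul_assoc e, hev, ← mul_assoc v,
        ← mul_assoc (v * x), ← mul_assoc (v * x), hx]
    have hgv : v * x * e * v = v := by rw [mul_assoc (v * x), hev, hx]
    have heg : e * (v * x * e) = v * x * e := by rw [← mul_assoc, ← mul_assoc, hev]
    have hge : v * x * e * e = v * x * e := by rw [mul_assoc (v * x), he]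
    have hvh : v * (x * v) = v := by rw [← mul_assoc, hx]
    have hhf : x * v * f = x * v := by rw [mul_assoc, hvf]
    refine ⟨LeftCat.of _ hg, LeftCat.of _ hxv,
      LeftCat.r e (v * x * e) (v * x * e) he hg hA (LeftCat.of_ideal _ hg) heg hg.eq,
      LeftCat.r (v * x * e) v (x * v) hg hxv (LeftCat.of_ideal _ hg) (LeftCat.of_ideal _ hxv)
        hgv hvh,
      LeftCat.r (x * v) (x * v) f hxv hf (LeftCat.of_ideal _ hxv) hB hxv.eq hhf, ?_, ?_, ?_, ?_⟩
    · refine ⟨LeftCat.r (v * x * e) (v * x * e) e hg he (LeftCat.of_ideal _ hg) hA hg.eq hge, fun y => ?_,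
        LeftCat.hom_ext fun y => ?_⟩
      · exact mul_of_mem_leftIdeal hg y.2
      · have hy := mul_of_mem_leftIdeal hg y.2
        rw [LeftCat.comp_val, LeftCat.r_val, LeftCat.r_val, LeftCat.id_val, hy, hy]
    · refine ⟨LeftCat.r (x * v) (x * v * (x * e)) (v * x * e) hxv hg (LeftCat.of_ideal _ hxv)
        (LeftCat.of_ideal _ hg)
        (by rw [← mul_assoc, hxv]) ?_, LeftCat.hom_ext fun y => ?_, LeftCat.hom_ext fun y => ?_⟩
      · have : x * v * (x * e) = x * (v * x * e) := by simp only [mul_assoc]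
        rw [this, mul_assoc, hg]
      · have hy := mul_of_mem_leftIdeal hg y.2
        rw [LeftCat.comp_val, LeftCat.r_val, LeftCat.r_val, LeftCat.id_val]
        have : (y : S) * v * (x * v * (x * e)) = y * (v * x * v * x * e) := by
          simp only [mul_assoc]
        rw [this, hx, hy]
      · have hy := mul_of_mem_leftIdeal hxv y.2
        rw [LeftCat.comp_val, LeftCat.r_val, LeftCat.r_val, LeftCat.id_val]
        have : (y : S) * (x * v * (x * e)) * v = y * (x * v) * x * (e * v) := by
          simp only [mul_assoc]
        rw [this, hy, hev, mul_assoc, hy]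
    · exact fun y => mul_of_mem_leftIdeal hxv y.2
    · refine LeftCat.hom_ext fun y => ?_
      rw [LeftCat.comp_val, LeftCat.comp_val, LeftCat.r_val, LeftCat.r_val, LeftCat.r_val, hφ,
        mul_assoc, mul_assoc, ← mul_assoc (v * x * e), hgv, hvh]
  exists_cone A := by
    obtain ⟨e, he, hA⟩ := A.exists_idempotent
    have key : ∀ B : LeftCat S, IsRightTranslation (A := B) (B := A)
        (fun x => ⟨x * e, hA ▸ ⟨x, rfl⟩⟩) := fun B => by
      obtain ⟨g, hg, hB⟩ := B.exists_idempotent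
      exact ⟨g, e, g * e, hg, he, hB, hA, ⟨e, by rw [mul_assoc, he]⟩, fun x => by
        rw [← mul_assoc, mul_of_mem_leftIdeal hg (hB ▸ x.2)]⟩
    have h1 : (⟨_, key A⟩ : A ⟶ A) = 𝟙 A := LeftCat.hom_ext fun x =>
      mul_of_mem_leftIdeal he (hA ▸ x.2)
    refine ⟨⟨fun B => ⟨_, key B⟩, fun {B D} j hj => LeftCat.hom_ext fun x => ?_, A, ?_⟩, h1⟩
    · rw [LeftCat.comp_val]
      change ((j.1 x : D.ideal) : S) * e = x * e
      rw [hj]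
    · rw [h1]
      infer_instance

/-! ### Totally left reductive semigroups -/

/-- A semigroup `S` is totally left reductive if it is regular and isomorphic to the semigroup
of all cones in `L(S)`. -/
def IsTotallyLeftReductive : ObjectProperty Semigrp.{u} := fun S =>
  ∃ _ : RegularSemigroup S, Nonempty (S ≃* Cones (LeftCat S))

/-- The category of totally left reductive semigroups and semigroup homomorphisms. -/
abbrev TotallyLeftReductiveSemigrp : Type (u + 1) :=
  ObjectProperty.FullSubcategory IsTotallyLeftReductive.{u}

end ConnCat

/-!
Choose for each object `c` of a normal category `C` an idempotent cone `u c` with vertex `c`.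
Sending a morphism `f : c ⟶ d` to the cone `u c ∗ f°` is multiplicative, and it identifies the
morphisms `c ⟶ d` with the elements of the form `u c * x * u d` of the semigroup `Ĉ` of cones; the
component at `c` of a cone `x` is the morphism that corresponds to `u c * x`. Everything is read off
from this:

* `C` is isomorphic to `L(Ĉ)` through `c ↦ Ĉ (u c)`, so every cone in `L(Ĉ)` is a cone of right
  multiplications, and `Ĉ` is totally left reductive;
* a CC-morphism `(F, G)` maps a cone `γ` with vertex `z` to the unique cone in the R-class
  `G(R_γ)` with vertex `F z` and components `F(γ(c))` at the objects `F c`, and this is a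
  homomorphism;
* conversely, a homomorphism `φ` determines `F` through `f ↦ u (F c) * φ (u c ∗ f°)`, where `F c`
  is the vertex of `φ (u c)`, so the functor `C ↦ Ĉ` is fully faithful.

It is essentially surjective because a totally left reductive semigroup `S` is, by definition,
isomorphic to the semigroup of cones of `L(S)`.
-/

namespace ConnCat

open CategoryWithSubobjects

/-! ### Principal left ideals -/

section LeftIdeal

variable {S T : Type u} [Semigroup S] [Semigroup T]

theorem leftIdeal_subset {a b : S} (h : a ∈ leftIdeal b) : leftIdeal a ⊆ leftIdeal b := by
  obtain ⟨y, rfl⟩ := h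
  rintro _ ⟨x, rfl⟩
  exact ⟨x * y, (mul_assoc _ _ _).symm⟩

theorem map_mem_leftIdeal (φ : S →ₙ* T) {a b : S} (h : a ∈ leftIdeal b) :
    φ a ∈ leftIdeal (φ b) := by
  obtain ⟨x, rfl⟩ := h
  exact ⟨φ x, map_mul φ x b⟩

theorem RightLE.map (φ : S →ₙ* T) {a b : S} (h : RightLE a b) : RightLE (φ a) (φ b) := by
  obtain ⟨x, rfl⟩ := h
  exact ⟨φ x, map_mul φ b x⟩

theorem exists_idempotent_leftIdeal_eq [RegularSemigroup S] (a : S) :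
    ∃ e : S, IsIdempotentElem e ∧ leftIdeal a = leftIdeal e := by
  obtain ⟨x, hx⟩ := RegularSemigroup.regular a
  refine ⟨x * a, by rw [IsIdempotentElem, mul_assoc, ← mul_assoc a, hx], ?_⟩
  exact (leftIdeal_subset ⟨a, by rw [← mul_assoc, hx]⟩).antisymm (leftIdeal_subset ⟨x, rfl⟩)

theorem self_mem_leftIdeal [RegularSemigroup S] (a : S) : a ∈ leftIdeal a := by
  obtain ⟨x, hx⟩ := RegularSemigroup.regular a
  exact ⟨a * x, hx.symm⟩

end LeftIdeal

/-! ### Subobjects and cones -/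

section Subobject

variable {C : Type u} [SmallCategory C] [CategoryWithSubobjects C]

/-- The partial order of subobjects on the objects of a category with subobjects: there is an
inclusion `a ⟶ b`. -/
def IsSubobject (a b : C) : Prop := ∃ j : a ⟶ b, incl j

theorem IsSubobject.refl (a : C) : IsSubobject a a := ⟨𝟙 a, incl_id a⟩

theorem IsSubobject.trans {a b c : C} (h : IsSubobject a b) (k : IsSubobject b c) :
    IsSubobject a c := by
  obtain ⟨f, hf⟩ := h
  obtain ⟨g, hg⟩ := k
  exact ⟨f ≫ g, incl_comp f g hf hg⟩

theorem IsSubobject.antisymm {a b : C} (h : IsSubobject a b) (k : IsSubobject b a) : a = b := by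
  obtain ⟨f, hf⟩ := h
  obtain ⟨g, hg⟩ := k
  exact incl_antisymm f g hf hg

theorem Cones.mk_injective (z : C) : Function.Injective (Cones.mk (C := C) z) :=
  fun _ _ h => eq_of_heq (Cones.mk.inj h).2

theorem Cones.exists_eq_mk (x : Cones C) {z : C} (h : x.vertex = z) :
    ∃ γ : ConeAt C z, x = ⟨z, γ⟩ := by
  subst h
  exact ⟨x.cone, rfl⟩

theorem ConeAt.exists_map_app_eq {D : Type u} [SmallCategory D] [CategoryWithSubobjects D]
    (F : C ⥤ D) [F.Full] [F.Faithful] (hF : ∀ {a b : C} (j : a ⟶ b), incl j → incl (F.map j))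
    (hsurj : Function.Surjective F.obj) {z : C} (Γ : ConeAt D (F.obj z)) :
    ∃ γ : ConeAt C z, ∀ c, F.map (γ.app c) = Γ.app (F.obj c) := by
  refine ⟨⟨fun c => F.preimage (Γ.app (F.obj c)), fun j hj => F.map_injective ?_, ?_⟩,
    fun c => F.map_preimage _⟩
  · rw [F.map_comp, F.map_preimage, F.map_preimage, Γ.incl_app _ (hF j hj)]
  · obtain ⟨d, hd⟩ := Γ.exists_isIso
    obtain ⟨c, rfl⟩ := hsurj d
    have : IsIso (F.map (F.preimage (Γ.app (F.obj c)))) := by rwa [F.map_preimage]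
    exact ⟨c, isIso_of_fully_faithful F _⟩

end Subobject

section Cones

variable {C : Type u} [SmallCategory C] [NormalCategory C]

theorem isCanonical_of_incl {a b : C} {j : a ⟶ b} (hj : incl j) : IsCanonical j (𝟙 a) j :=
  ⟨IsNormalEpi.of_isIso _, hj, (Category.id_comp j).symm⟩

theorem IsNormalEpi.isCanonical {a b : C} {p : a ⟶ b} (hp : IsNormalEpi p) :
    IsCanonical p p (𝟙 b) :=
  ⟨hp, incl_id b, (Category.comp_id p).symm⟩

theorem IsCanonical.comp_incl {a b c z : C} {f : a ⟶ b} {p : a ⟶ z} {j : z ⟶ b}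
    (h : IsCanonical f p j) {k : b ⟶ c} (hk : incl k) : IsCanonical (f ≫ k) p (j ≫ k) :=
  ⟨h.1, incl_comp j k h.2.1 hk, by rw [h.2.2, Category.assoc]⟩

theorem IsCanonical.epi_comp {a b c z : C} {f : b ⟶ c} {p : b ⟶ z} {j : z ⟶ c}
    (h : IsCanonical f p j) {q : a ⟶ b} (hq : IsNormalEpi q) :
    IsCanonical (q ≫ f) (q ≫ p) j :=
  ⟨hq.comp h.1, h.2.1, by rw [h.2.2, Category.assoc]⟩

theorem ConeAt.star_id {z : C} (γ : ConeAt C z) (h : IsNormalEpi (𝟙 z)) : γ.star (𝟙 z) h = γ :=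
  ConeAt.ext (funext fun _ => Category.comp_id _)

theorem ConeAt.star_inv {z w : C} (γ : ConeAt C z) (p : z ⟶ w) [IsIso p]
    (hp : IsNormalEpi p) (hp' : IsNormalEpi (inv p)) : (γ.star p hp).star (inv p) hp' = γ := by
  ext c
  simp only [ConeAt.star, Category.assoc, IsIso.hom_inv_id, Category.comp_id]

theorem Cones.isSubobject_vertex_mul (x y : Cones C) : IsSubobject (x * y).vertex y.vertex :=
  ⟨inclPart _, (isCanonical _).2.1⟩

theorem Cones.mul_eq_left_iff {x e : Cones C} (he : IsIdempotentElem e) :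
    x * e = x ↔ IsSubobject x.vertex e.vertex := by
  refine ⟨fun h => h ▸ x.isSubobject_vertex_mul e, fun ⟨k, hk⟩ => ?_⟩
  have happ : e.cone.app x.vertex = k := by
    rw [← e.cone.incl_app k hk, (isIdempotentElem_iff e.cone).1 he, Category.comp_id]
  have hc : IsCanonical (e.cone.app x.vertex) (𝟙 x.vertex) k := by
    rw [happ]
    exact isCanonical_of_incl hk
  exact (mul_eq x.cone e.cone hc).trans (congrArg (Cones.mk _) (x.cone.star_id _))

theorem Cones.mem_leftIdeal_iff {x y : Cones C} :
    x ∈ leftIdeal y ↔ IsSubobject x.vertex y.vertex := by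
  have vertex_le {x y : Cones C} : x ∈ leftIdeal y → IsSubobject x.vertex y.vertex := by
    rintro ⟨s, rfl⟩
    exact s.isSubobject_vertex_mul y
  obtain ⟨e, he, hye⟩ := exists_idempotent_leftIdeal_eq y
  refine ⟨vertex_le, fun h => hye ▸ ⟨x, (Eq.symm ((mul_eq_left_iff he).2 (h.trans ?_)))⟩⟩
  exact vertex_le (hye ▸ self_mem_leftIdeal y)

/-! ### Morphisms as cones -/

/-- A chosen idempotent cone with vertex `c`. -/
noncomputable def unitConeAt (c : C) : ConeAt C c := (NormalCategory.exists_cone c).choose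

/-- The chosen idempotent cone with vertex `c`, as an element of the semigroup of cones. -/
noncomputable abbrev unitCone (c : C) : Cones C := ⟨c, unitConeAt c⟩

theorem unitConeAt_app_self (c : C) : (unitConeAt c).app c = 𝟙 c :=
  (NormalCategory.exists_cone c).choose_spec

theorem isIdempotentElem_unitCone (c : C) : IsIdempotentElem (unitCone c) :=
  (isIdempotentElem_iff _).2 (unitConeAt_app_self c)

theorem mul_unitCone_eq_left_iff {x : Cones C} {c : C} :
    x * unitCone c = x ↔ IsSubobject x.vertex c :=
  Cones.mul_eq_left_iff (isIdempotentElem_unitCone c)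

/-- The cone `u ∗ f°`, where `u` is the chosen idempotent cone at the source of `f`. It represents
the morphism `f` in the semigroup of cones. -/
noncomputable abbrev ofHom {c d : C} (f : c ⟶ d) : Cones C :=
  ⟨im f, (unitConeAt c).star (epiPart f) (isCanonical f).1⟩

theorem ofHom_eq {c d z : C} {f : c ⟶ d} {p : c ⟶ z} {j : z ⟶ d} (h : IsCanonical f p j) :
    ofHom f = ⟨z, (unitConeAt c).star p h.1⟩ :=
  star_congr _ _ _ (canonical_unique (isCanonical f) h)

theorem ofHom_app_self {c d : C} (f : c ⟶ d) : (ofHom f).cone.app c = epiPart f := by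
  change (unitConeAt c).app c ≫ epiPart f = epiPart f
  rw [unitConeAt_app_self, Category.id_comp]

theorem unitCone_mul {c : C} (x : Cones C) : unitCone c * x = ofHom (x.cone.app c) := rfl

theorem ofHom_injective {c d : C} : Function.Injective (ofHom : (c ⟶ d) → Cones C) := by
  intro f g h
  obtain ⟨z, p, j, hf⟩ := exists_canonical f
  obtain ⟨w, q, k, hg⟩ := exists_canonical g
  rw [ofHom_eq hf, ofHom_eq hg] at h
  obtain rfl : z = w := congrArg Cones.vertex h
  have happ := congrFun (congrArg ConeAt.app (Cones.mk_injective _ h)) c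
  have hpq : p = q := by
    simpa only [ConeAt.star, unitConeAt_app_self, Category.id_comp] using happ
  rw [hf.2.2, hg.2.2, hpq, incl_unique j k hf.2.1 hg.2.1]

theorem ofHom_id (c : C) : ofHom (𝟙 c) = unitCone c := by
  rw [← unitConeAt_app_self]
  exact isIdempotentElem_unitCone c

theorem ofHom_comp_incl {a b c : C} (f : a ⟶ b) {k : b ⟶ c} (hk : incl k) :
    ofHom (f ≫ k) = ofHom f :=
  ofHom_eq ((isCanonical f).comp_incl hk)

theorem ofHom_of_incl {a b : C} {j : a ⟶ b} (hj : incl j) : ofHom j = unitCone a := by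
  rw [← Category.id_comp j, ofHom_comp_incl _ hj, ofHom_id]

theorem ofHom_comp {a b c : C} (f : a ⟶ b) (g : b ⟶ c) :
    ofHom (f ≫ g) = ofHom f * ofHom g := by
  have happ : (ofHom g).cone.app (im f) = inclPart f ≫ epiPart g := by
    rw [← ofHom_app_self, (ofHom g).cone.incl_app _ (isCanonical f).2.1]
  obtain ⟨z, p, j, h⟩ := exists_canonical (inclPart f ≫ epiPart g)
  have hfg : IsCanonical (f ≫ g) (epiPart f ≫ p) (j ≫ inclPart g) := by
    have := (h.epi_comp (isCanonical f).1).comp_incl (isCanonical g).2.1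
    rwa [Category.assoc, Category.assoc, ← (isCanonical g).2.2, ← Category.assoc,
      ← (isCanonical f).2.2] at this
  rw [ofHom_eq hfg, ← star_star _ _ _ (isCanonical f).1 h.1]
  exact (mul_eq _ _ (happ ▸ h)).symm

theorem unitCone_mul_ofHom {c d : C} (f : c ⟶ d) : unitCone c * ofHom f = ofHom f := by
  rw [← ofHom_id, ← ofHom_comp, Category.id_comp]

theorem ofHom_mul_unitCone {c d : C} (f : c ⟶ d) : ofHom f * unitCone d = ofHom f := by
  rw [← ofHom_id, ← ofHom_comp, Category.comp_id]

theorem exists_ofHom_eq {c d : C} {x : Cones C} (hc : unitCone c * x = x)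
    (hd : x * unitCone d = x) : ∃ f : c ⟶ d, ofHom f = x := by
  obtain ⟨j, hj⟩ := mul_unitCone_eq_left_iff.1 hd
  exact ⟨x.cone.app c ≫ j, by rw [ofHom_comp_incl _ hj, ← unitCone_mul, hc]⟩

theorem heq_of_ofHom_eq {a a' b b' : C} (ha : a = a') (hb : b = b') {f : a ⟶ b} {g : a' ⟶ b'}
    (h : ofHom f = ofHom g) : HEq f g := by
  subst ha hb
  exact heq_of_eq (ofHom_injective h)

/-! ### Green's relation R on cones -/

theorem mk_mul_ofHom {z w : C} (γ : ConeAt C z) {p : z ⟶ w} (hp : IsNormalEpi p) :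
    ⟨z, γ⟩ * ofHom p = ⟨w, γ.star p hp⟩ := by
  rw [ofHom_eq hp.isCanonical]
  refine mul_eq _ _ (j := 𝟙 w) ?_
  change IsCanonical ((unitConeAt z).app z ≫ p) p (𝟙 w)
  rw [unitConeAt_app_self, Category.id_comp]
  exact hp.isCanonical

theorem rClass_star_le {z w : C} (γ : ConeAt C z) {p : z ⟶ w} (hp : IsNormalEpi p) :
    rClass (⟨w, γ.star p hp⟩ : Cones C) ≤ rClass (⟨z, γ⟩ : Cones C) :=
  ⟨ofHom p, (mk_mul_ofHom γ hp).symm⟩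

theorem exists_star_eq_of_rClass_le {z w : C} {γ : ConeAt C z} {δ : ConeAt C w}
    (h : rClass (⟨w, δ⟩ : Cones C) ≤ rClass (⟨z, γ⟩ : Cones C)) :
    ∃ (p : z ⟶ w) (hp : IsNormalEpi p), δ = γ.star p hp := by
  obtain ⟨η, h⟩ := h
  obtain ⟨v, p, j, hc⟩ := exists_canonical (η.cone.app z)
  replace h := h.trans (mul_eq γ η.cone hc)
  obtain rfl : w = v := congrArg Cones.vertex h
  exact ⟨p, hc.1, Cones.mk_injective _ h⟩

theorem rClass_star_of_isIso {z w : C} (γ : ConeAt C z) (p : z ⟶ w) [IsIso p]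
    (hp : IsNormalEpi p) : rClass (⟨w, γ.star p hp⟩ : Cones C) = rClass (⟨z, γ⟩ : Cones C) := by
  refine (rClass_star_le γ hp).antisymm ?_
  have := rClass_star_le (γ.star p hp) (IsNormalEpi.of_isIso (inv p))
  rwa [γ.star_inv] at this

theorem ConeAt.eq_of_rClass_le {z w : C} {γ : ConeAt C z} {δ δ' : ConeAt C w}
    (h : rClass (⟨w, δ⟩ : Cones C) ≤ rClass (⟨z, γ⟩ : Cones C))
    (h' : rClass (⟨w, δ'⟩ : Cones C) ≤ rClass (⟨z, γ⟩ : Cones C)) (b : C) [IsIso (γ.app b)]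
    (happ : δ.app b = δ'.app b) : δ = δ' := by
  obtain ⟨p, hp, rfl⟩ := exists_star_eq_of_rClass_le h
  obtain ⟨p', hp', rfl⟩ := exists_star_eq_of_rClass_le h'
  obtain rfl : p = p' := (cancel_epi (γ.app b)).1 happ
  rfl

end Cones

/-! ### Cones of principal left ideals -/

section LeftCat

variable {S : Type u} [Semigroup S]

theorem LeftCat.exists_mul {A B : LeftCat S} (φ : A ⟶ B) :
    ∃ v : S, ∀ x : A.ideal, (φ.1 x : S) = x * v := by
  obtain ⟨e, f, v, -, -, -, -, -, h⟩ := φ.2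
  exact ⟨v, h⟩

/-- Right multiplication by `s`, as a morphism of `L(S)`. -/
def LeftCat.mulRight (A B : LeftCat S) (s : S) (h : ∀ x ∈ A.ideal, x * s ∈ B.ideal) : A ⟶ B :=
  ⟨fun x => ⟨x * s, h x x.2⟩, by
    obtain ⟨e, he, hA⟩ := A.exists_idempotent
    obtain ⟨f, hf, hB⟩ := B.exists_idempotent
    refine ⟨e, f, e * s * f, he, hf, hA, hB, ⟨s, rfl⟩, fun x => ?_⟩
    have hxe : (x : S) * e = x := mul_of_mem_leftIdeal he (hA ▸ x.2)
    have hxf : (x : S) * s * f = x * s := mul_of_mem_leftIdeal hf (hB ▸ h x x.2)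
    rw [← mul_assoc, ← mul_assoc, hxe, hxf]⟩

theorem LeftCat.isSubobject_of_subset {A B : LeftCat S} (h : A.ideal ⊆ B.ideal) :
    IsSubobject A B := by
  obtain ⟨e, he, hA⟩ := A.exists_idempotent
  have hxe : ∀ x ∈ A.ideal, x * e = x := fun x hx => mul_of_mem_leftIdeal he (hA ▸ hx)
  exact ⟨LeftCat.mulRight A B e fun x hx => (hxe x hx).symm ▸ h hx, fun x => hxe x x.2⟩

theorem LeftCat.epi_of_surjective {A B : LeftCat S} (φ : A ⟶ B) (h : Function.Surjective φ.1) :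
    Epi φ where
  left_cancellation g k hgk := LeftCat.hom_ext fun y => by
    obtain ⟨x, rfl⟩ := h y
    rw [← LeftCat.comp_val, hgk, LeftCat.comp_val]

theorem LeftCat.cones_ext {Γ Δ : Cones (LeftCat S)} (hvertex : Γ.vertex = Δ.vertex)
    (happ : ∀ (A : LeftCat S) (x : A.ideal), ((Γ.cone.app A).1 x : S) = (Δ.cone.app A).1 x) :
    Γ = Δ := by
  obtain ⟨z, Γ⟩ := Γ
  obtain ⟨w, Δ⟩ := Δ
  obtain rfl : z = w := hvertex
  exact congrArg (Cones.mk z) (ConeAt.ext (funext fun A => LeftCat.hom_ext (happ A)))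

variable [RegularSemigroup S]

/-- The object `Sa` of `L(S)`, for an element `a` that need not be idempotent. -/
def LeftCat.span (a : S) : LeftCat S := ⟨leftIdeal a, exists_idempotent_leftIdeal_eq a⟩

/-- The cone of `L(S)` with vertex `Sa` whose components are right multiplication by `a`. -/
def mulCone (a : S) : ConeAt (LeftCat S) (LeftCat.span a) where
  app A := LeftCat.mulRight A _ a fun x _ => ⟨x, rfl⟩
  incl_app j hj := LeftCat.hom_ext fun x => congrArg (· * a) (hj x)
  exists_isIso := by
    obtain ⟨x, hx⟩ := RegularSemigroup.regular a
    refine ⟨LeftCat.span (a * x), LeftCat.mulRight _ _ x ?_, LeftCat.hom_ext ?_,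
      LeftCat.hom_ext ?_⟩
    · rintro _ ⟨s, rfl⟩
      exact ⟨s, mul_assoc _ _ _⟩
    · rintro ⟨_, s, rfl⟩
      change s * (a * x) * a * x = s * (a * x)
      rw [mul_assoc s, hx, mul_assoc]
    · rintro ⟨_, s, rfl⟩
      change s * a * x * a = s * a
      rw [mul_assoc s, mul_assoc s, hx]

theorem mk_mulCone_mul (a b : S) :
    (⟨LeftCat.span (a * b), mulCone (a * b)⟩ : Cones (LeftCat S)) =
      ⟨LeftCat.span a, mulCone a⟩ * ⟨LeftCat.span b, mulCone b⟩ := by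
  let p : LeftCat.span a ⟶ LeftCat.span (a * b) := LeftCat.mulRight _ _ b <| by
    rintro _ ⟨s, rfl⟩
    exact ⟨s, mul_assoc _ _ _⟩
  have hp : Epi p := LeftCat.epi_of_surjective p <| by
    rintro ⟨_, s, rfl⟩
    exact ⟨⟨s * a, s, rfl⟩, Subtype.ext (mul_assoc _ _ _)⟩
  obtain ⟨j, hj⟩ : IsSubobject (LeftCat.span (a * b)) (LeftCat.span b) :=
    LeftCat.isSubobject_of_subset (leftIdeal_subset ⟨a, rfl⟩)
  have hc : IsCanonical ((mulCone b).app (LeftCat.span a)) p j :=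
    ⟨IsNormalEpi.of_epi p, hj, LeftCat.hom_ext fun x => (hj (p.1 x)).symm⟩
  rw [mul_eq _ _ hc]
  exact LeftCat.cones_ext rfl fun A x => (mul_assoc (x : S) a b).symm

variable (S) in
/-- The representation of a regular semigroup by cones of right multiplications. -/
def mulConeHom : S →ₙ* Cones (LeftCat S) where
  toFun a := ⟨LeftCat.span a, mulCone a⟩
  map_mul' := mk_mulCone_mul

end LeftCat

/-! ### Semigroups of cones are totally left reductive -/

section IdealFunctor

variable {C : Type u} [SmallCategory C] [NormalCategory C]

variable (C) in
/-- The isomorphism of `C` with the category `L(Ĉ)`, where `Ĉ` is the semigroup of cones of `C`. It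
sends `c` to the left ideal of the cones whose vertex is a subobject of `c`. -/
noncomputable def idealFunctor : C ⥤ LeftCat (Cones C) where
  obj c := LeftCat.span (unitCone c)
  map {c d} f := LeftCat.mulRight _ _ (ofHom f) fun x _ =>
    ⟨x * ofHom f, by rw [mul_assoc, ofHom_mul_unitCone]⟩
  map_id c := LeftCat.hom_ext fun x => by
    change (x : Cones C) * ofHom (𝟙 c) = x
    rw [ofHom_id, mul_of_mem_leftIdeal (isIdempotentElem_unitCone c) x.2]
  map_comp f g := LeftCat.hom_ext fun x => by
    change (x : Cones C) * ofHom (f ≫ g) = x * ofHom f * ofHom g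
    rw [ofHom_comp, mul_assoc]

theorem idealFunctor_map_apply {c d : C} (f : c ⟶ d) (x : ((idealFunctor C).obj c).ideal) :
    (((idealFunctor C).map f).1 x : Cones C) = x * ofHom f := rfl

theorem mul_unitCone_of_mem {c : C} {x : Cones C} (hx : x ∈ ((idealFunctor C).obj c).ideal) :
    x * unitCone c = x :=
  mul_of_mem_leftIdeal (isIdempotentElem_unitCone c) hx

theorem unitCone_mem (c : C) : unitCone c ∈ ((idealFunctor C).obj c).ideal :=
  self_mem_leftIdeal (unitCone c)

theorem span_eq_idealFunctor_obj (x : Cones C) :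
    LeftCat.span x = (idealFunctor C).obj x.vertex :=
  LeftCat.ext (Set.ext fun _ =>
    Cones.mem_leftIdeal_iff.trans (Cones.mem_leftIdeal_iff (y := unitCone x.vertex)).symm)

theorem idealFunctor_map_incl {a b : C} {j : a ⟶ b} (hj : incl j) :
    incl ((idealFunctor C).map j) := fun x => by
  rw [idealFunctor_map_apply, ofHom_of_incl hj, mul_unitCone_of_mem x.2]

theorem idealFunctor_obj_injective : Function.Injective (idealFunctor C).obj := by
  have vertex_le {c d : C} (h : (idealFunctor C).obj c = (idealFunctor C).obj d) :
      IsSubobject c d :=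
    Cones.mem_leftIdeal_iff (y := unitCone d).1 (h ▸ unitCone_mem c)
  exact fun c d h => (vertex_le h).antisymm (vertex_le h.symm)

theorem idealFunctor_obj_surjective : Function.Surjective (idealFunctor C).obj := fun A => by
  obtain ⟨e, -, hA⟩ := A.exists_idempotent
  exact ⟨e.vertex, (span_eq_idealFunctor_obj e).symm.trans (LeftCat.ext hA.symm)⟩

instance : (idealFunctor C).Faithful where
  map_injective {c d f g} h := ofHom_injective <| by
    have := congrArg (fun φ => (φ.1 ⟨unitCone c, unitCone_mem c⟩ : Cones C)) h
    simpa only [idealFunctor_map_apply, unitCone_mul_ofHom] using this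

instance : (idealFunctor C).Full where
  map_surjective {c d} φ := by
    obtain ⟨v, hv⟩ := LeftCat.exists_mul φ
    have hd : unitCone c * v * unitCone d = unitCone c * v :=
      mul_unitCone_of_mem (hv ⟨_, unitCone_mem c⟩ ▸ (φ.1 _).2)
    obtain ⟨f, hf⟩ := exists_ofHom_eq (c := c)
      (by rw [← mul_assoc, isIdempotentElem_unitCone]) hd
    refine ⟨f, LeftCat.hom_ext fun x => ?_⟩
    rw [idealFunctor_map_apply, hf, hv, ← mul_assoc, mul_unitCone_of_mem x.2]

theorem mulConeHom_injective : Function.Injective (mulConeHom (Cones C)) := by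
  rintro ⟨z, α⟩ b h
  have hmul : ∀ c, unitCone c * ⟨z, α⟩ = unitCone c * b := fun c =>
    congrArg (fun Γ : Cones (LeftCat (Cones C)) =>
      ((Γ.cone.app ((idealFunctor C).obj c)).1 ⟨_, unitCone_mem c⟩ : Cones C)) h
  have hvertex : b.vertex = z := idealFunctor_obj_injective <| by
    rw [← span_eq_idealFunctor_obj b]
    exact (congrArg Cones.vertex h).symm.trans (span_eq_idealFunctor_obj ⟨z, α⟩)
  obtain ⟨β, rfl⟩ := b.exists_eq_mk hvertex
  exact congrArg (Cones.mk z) (ConeAt.ext (funext fun c => ofHom_injective (hmul c)))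

theorem mulConeHom_surjective : Function.Surjective (mulConeHom (Cones C)) := by
  rintro ⟨A, Γ⟩
  obtain ⟨z, rfl⟩ := idealFunctor_obj_surjective A
  obtain ⟨γ, hγ⟩ := ConeAt.exists_map_app_eq (idealFunctor C) (fun _ => idealFunctor_map_incl)
    idealFunctor_obj_surjective Γ
  refine ⟨⟨z, γ⟩, LeftCat.cones_ext (span_eq_idealFunctor_obj _) fun B x => ?_⟩
  obtain ⟨c, rfl⟩ := idealFunctor_obj_surjective B
  change (x : Cones C) * ⟨z, γ⟩ = (Γ.app _).1 x
  rw [← hγ, idealFunctor_map_apply, ← unitCone_mul ⟨z, γ⟩, ← mul_assoc, mul_unitCone_of_mem x.2]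

variable (C) in
theorem isTotallyLeftReductive_cones : IsTotallyLeftReductive (Semigrp.of (Cones C)) :=
  ⟨inferInstanceAs (RegularSemigroup (Cones C)),
    ⟨MulEquiv.ofBijective (mulConeHom (Cones C)) ⟨mulConeHom_injective, mulConeHom_surjective⟩⟩⟩

end IdealFunctor

/-! ### The homomorphism of a CC-morphism -/

section IsConnectedBy

variable {C : Type u} [SmallCategory C] [NormalCategory C] {c : C} {d : RClass (Cones C)}

theorem IsConnectedBy.isIdempotentElem_cone (h : IsConnectedBy c d) :
    IsIdempotentElem (⟨c, h.cone⟩ : Cones C) :=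
  h.choose_spec.1

theorem IsConnectedBy.rClass_cone (h : IsConnectedBy c d) :
    rClass (⟨c, h.cone⟩ : Cones C) = d :=
  h.choose_spec.2

theorem IsConnectedBy.cone_eq (h : IsConnectedBy c d) {ε : ConeAt C c}
    (hε : IsIdempotentElem (⟨c, ε⟩ : Cones C)) (hd : rClass (⟨c, ε⟩ : Cones C) = d) :
    h.cone = ε :=
  idempotent_unique _ _ h.isIdempotentElem_cone hε (h.rClass_cone.trans hd.symm)

end IsConnectedBy

namespace NormalCat

variable {C D E : NormalCat.{u}}

/-- The functor `F` of a CC-morphism `(F, G)` of normal categories. -/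
def functorOf (f : C ⟶ D) : C.carrier ⥤ D.carrier := CCMorphism.functor f

/-- The map `G` of a CC-morphism `(F, G)` of normal categories, defined on the R-classes themselves
instead of on the down-set of all R-classes. -/
noncomputable def rClassMap (f : C ⟶ D) : RClass (Cones C.carrier) →o RClass (Cones D.carrier) where
  toFun d := (CCMorphism.map f ⟨d, trivial⟩).1
  monotone' _ _ h := (CCMorphism.map f).monotone h

theorem functorOf_map_incl (f : C ⟶ D) {a b : C.carrier} {j : a ⟶ b} (hj : incl j) :
    incl ((functorOf f).map j) :=
  CCMorphism.map_incl f j hj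

theorem isConnectedBy_map (f : C ⟶ D) {c : C.carrier} {d : RClass (Cones C.carrier)}
    (h : IsConnectedBy c d) : IsConnectedBy ((functorOf f).obj c) (rClassMap f d) :=
  CCMorphism.connected f c ⟨d, trivial⟩ h

theorem isConnectedBy_map_cone_app (f : C ⟶ D) {c : C.carrier} {d : RClass (Cones C.carrier)}
    (h : IsConnectedBy c d) (c' : C.carrier) :
    (isConnectedBy_map f h).cone.app ((functorOf f).obj c') =
      (functorOf f).map (h.cone.app c') :=
  (CCMorphism.map_cone f c ⟨d, trivial⟩ h c').symm

theorem exists_coneMap (f : C ⟶ D) {z : C.carrier} (γ : ConeAt C.carrier z) :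
    ∃ δ : ConeAt D.carrier ((functorOf f).obj z),
      rClass (⟨_, δ⟩ : Cones D.carrier) = rClassMap f (rClass ⟨z, γ⟩) ∧
        ∀ c, δ.app ((functorOf f).obj c) = (functorOf f).map (γ.app c) := by
  obtain ⟨b, hb⟩ := γ.exists_isIso
  let ε := γ.star (inv (γ.app b)) (IsNormalEpi.of_isIso _)
  have hε : IsIdempotentElem (⟨b, ε⟩ : Cones C.carrier) :=
    (isIdempotentElem_iff ε).2 (IsIso.hom_inv_id (γ.app b))
  have hclass : rClass (⟨b, ε⟩ : Cones C.carrier) = rClass ⟨z, γ⟩ := rClass_star_of_isIso _ _ _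
  have hconn : IsConnectedBy b (rClass (⟨z, γ⟩ : Cones C.carrier)) := ⟨ε, hε, hclass⟩
  refine ⟨(isConnectedBy_map f hconn).cone.star ((functorOf f).map (γ.app b))
    (IsNormalEpi.of_isIso _),
    (rClass_star_of_isIso _ _ _).trans (isConnectedBy_map f hconn).rClass_cone, fun c => ?_⟩
  change (isConnectedBy_map f hconn).cone.app _ ≫ _ = _
  rw [isConnectedBy_map_cone_app f hconn, hconn.cone_eq hε hclass, ← Functor.map_comp]
  simp only [ε, ConeAt.star, Category.assoc, IsIso.inv_hom_id, Category.comp_id]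

/-- A CC-morphism given by its action on all cones, idempotent or not. -/
noncomputable def homMk (F : C.carrier ⥤ D.carrier)
    (G : RClass (Cones C.carrier) →o RClass (Cones D.carrier))
    (map_incl : ∀ {a b : C.carrier} (j : a ⟶ b), incl j → incl (F.map j))
    (hcone : ∀ {z : C.carrier} (γ : ConeAt C.carrier z), ∃ δ : ConeAt D.carrier (F.obj z),
      rClass (⟨_, δ⟩ : Cones D.carrier) = G (rClass ⟨z, γ⟩) ∧
        ∀ c, δ.app (F.obj c) = F.map (γ.app c)) : C ⟶ D :=
  have exists_idempotent {c : C.carrier} {d : RClass (Cones C.carrier)} (h : IsConnectedBy c d) :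
      ∃ δ : ConeAt D.carrier (F.obj c), IsIdempotentElem (⟨_, δ⟩ : Cones D.carrier) ∧
        rClass (⟨_, δ⟩ : Cones D.carrier) = G d ∧
          ∀ c', δ.app (F.obj c') = F.map (h.cone.app c') := by
    obtain ⟨δ, hδ, happ⟩ := hcone h.cone
    refine ⟨δ, (isIdempotentElem_iff δ).2 ?_, hδ.trans (congrArg G h.rClass_cone), happ⟩
    rw [happ, (isIdempotentElem_iff _).1 h.isIdempotentElem_cone, F.map_id]
  { functor := F
    map := ⟨fun d => ⟨G d.1, trivial⟩, fun _ _ h => G.monotone h⟩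
    map_incl := map_incl
    connected := fun c d h =>
      let ⟨δ, hδ, hclass, _⟩ := exists_idempotent h
      ⟨δ, hδ, hclass⟩
    map_cone := fun c d h c' => by
      obtain ⟨δ, hδ, hclass, happ⟩ := exists_idempotent h
      exact (happ c').symm.trans
        (congrArg (fun ε => ε.app (F.obj c')) (IsConnectedBy.cone_eq _ hδ hclass).symm) }

/-- The image of a cone `γ` with vertex `z` under a CC-morphism `(F, G)`: the cone with vertex `F z`
in the R-class `G(R_γ)` whose component at each object `F c` is `F (γ c)`. -/
noncomputable def coneMap (f : C ⟶ D) {z : C.carrier} (γ : ConeAt C.carrier z) :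
    ConeAt D.carrier ((functorOf f).obj z) :=
  (exists_coneMap f γ).choose

theorem rClass_coneMap (f : C ⟶ D) {z : C.carrier} (γ : ConeAt C.carrier z) :
    rClass (⟨_, coneMap f γ⟩ : Cones D.carrier) = rClassMap f (rClass ⟨z, γ⟩) :=
  (exists_coneMap f γ).choose_spec.1

theorem coneMap_app (f : C ⟶ D) {z : C.carrier} (γ : ConeAt C.carrier z) (c : C.carrier) :
    (coneMap f γ).app ((functorOf f).obj c) = (functorOf f).map (γ.app c) :=
  (exists_coneMap f γ).choose_spec.2 c

theorem eq_of_rClass_le_rClassMap (f : C ⟶ D) {z : C.carrier} (γ : ConeAt C.carrier z)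
    {w : D.carrier} {δ δ' : ConeAt D.carrier w}
    (h : rClass (⟨w, δ⟩ : Cones D.carrier) ≤ rClassMap f (rClass ⟨z, γ⟩))
    (h' : rClass (⟨w, δ'⟩ : Cones D.carrier) ≤ rClassMap f (rClass ⟨z, γ⟩))
    (happ : ∀ c, δ.app ((functorOf f).obj c) = δ'.app ((functorOf f).obj c)) : δ = δ' := by
  obtain ⟨b, hb⟩ := γ.exists_isIso
  have : IsIso ((coneMap f γ).app ((functorOf f).obj b)) := by
    rw [coneMap_app]
    infer_instance
  rw [← rClass_coneMap] at h h'
  exact ConeAt.eq_of_rClass_le h h' _ (happ b)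

theorem coneMap_unique (f : C ⟶ D) {z : C.carrier} {γ : ConeAt C.carrier z}
    {δ : ConeAt D.carrier ((functorOf f).obj z)}
    (hclass : rClass (⟨_, δ⟩ : Cones D.carrier) = rClassMap f (rClass ⟨z, γ⟩))
    (happ : ∀ c, δ.app ((functorOf f).obj c) = (functorOf f).map (γ.app c)) : coneMap f γ = δ :=
  eq_of_rClass_le_rClassMap f γ (rClass_coneMap f γ).le hclass.le
    fun c => (coneMap_app f γ c).trans (happ c).symm

theorem isNormalEpi_map (f : C ⟶ D) {a b : C.carrier} {p : a ⟶ b} (hp : IsNormalEpi p) :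
    IsNormalEpi ((functorOf f).map p) := by
  obtain ⟨i, hi⟩ := hp.exists_section
  have : IsSplitEpi p := ⟨⟨⟨i, hi⟩⟩⟩
  exact IsNormalEpi.of_epi _

theorem isCanonical_map (f : C ⟶ D) {a b z : C.carrier} {g : a ⟶ b} {p : a ⟶ z} {j : z ⟶ b}
    (h : IsCanonical g p j) :
    IsCanonical ((functorOf f).map g) ((functorOf f).map p) ((functorOf f).map j) :=
  ⟨isNormalEpi_map f h.1, functorOf_map_incl f h.2.1, by rw [h.2.2, Functor.map_comp]⟩

theorem coneMap_star (f : C ⟶ D) {z w : C.carrier} (γ : ConeAt C.carrier z) {p : z ⟶ w}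
    (hp : IsNormalEpi p) :
    coneMap f (γ.star p hp) =
      (coneMap f γ).star ((functorOf f).map p) (isNormalEpi_map f hp) := by
  refine eq_of_rClass_le_rClassMap f γ ?_ ?_ fun c => ?_
  · rw [rClass_coneMap]
    exact (rClassMap f).monotone (rClass_star_le γ hp)
  · rw [← rClass_coneMap]
    exact rClass_star_le _ _
  · rw [coneMap_app]
    change _ = (coneMap f γ).app _ ≫ _
    rw [coneMap_app, ← Functor.map_comp]
    rfl

/-- The homomorphism between semigroups of cones induced by a CC-morphism. -/
noncomputable def coneHom (f : C ⟶ D) : Cones C.carrier →ₙ* Cones D.carrier where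
  toFun x := ⟨(functorOf f).obj x.vertex, coneMap f x.cone⟩
  map_mul' := by
    rintro ⟨a, γ⟩ ⟨b, δ⟩
    obtain ⟨z, p, j, h⟩ := exists_canonical (δ.app a)
    have h' := isCanonical_map f h
    rw [← coneMap_app] at h'
    rw [mul_eq γ δ h, mul_eq _ _ h', coneMap_star]

theorem rClass_coneHom (f : C ⟶ D) (x : Cones C.carrier) :
    rClass (coneHom f x) = rClassMap f (rClass x) :=
  rClass_coneMap f x.cone

theorem coneHom_id (C : NormalCat.{u}) : coneHom (𝟙 C) = MulHom.id (Cones C.carrier) :=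
  MulHom.ext fun _ => congrArg (Cones.mk _) (coneMap_unique (𝟙 C) rfl fun _ => rfl)

theorem coneHom_comp (f : C ⟶ D) (g : D ⟶ E) : coneHom (f ≫ g) = (coneHom g).comp (coneHom f) := by
  ext x : 1
  refine congrArg (Cones.mk _) (coneMap_unique (f ≫ g) (δ := coneMap g (coneMap f x.cone)) ?_
    fun c => ?_)
  · exact (rClass_coneMap g _).trans (congrArg (rClassMap g) (rClass_coneMap f x.cone))
  · exact (coneMap_app g _ _).trans (congrArg (functorOf g).map (coneMap_app f _ c))

theorem ofHom_functorOf_map (f : C ⟶ D) {a b : C.carrier} (g : a ⟶ b) :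
    ofHom ((functorOf f).map g) = unitCone ((functorOf f).obj a) * coneHom f (ofHom g) :=
  calc ofHom ((functorOf f).map g)
    _ = ofHom ((functorOf f).map (epiPart g) ≫ (functorOf f).map (inclPart g)) := by
      rw [← Functor.map_comp, ← (isCanonical g).2.2]
    _ = ofHom ((functorOf f).map (epiPart g)) :=
      ofHom_comp_incl _ (functorOf_map_incl f (isCanonical g).2.1)
    _ = ofHom ((coneMap f (ofHom g).cone).app ((functorOf f).obj a)) := by
      rw [coneMap_app, ofHom_app_self]

theorem coneHom_injective : Function.Injective (coneHom : (C ⟶ D) → _) := by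
  intro f g h
  have hobj (a : C.carrier) : (functorOf f).obj a = (functorOf g).obj a :=
    congrArg Cones.vertex (DFunLike.congr_fun h (unitCone a))
  have hmap {a b : C.carrier} (k : a ⟶ b) : HEq ((functorOf f).map k) ((functorOf g).map k) :=
    heq_of_ofHom_eq (hobj a) (hobj b) <| by
      rw [ofHom_functorOf_map, ofHom_functorOf_map, h, hobj]
  have hclass (d : RClass (Cones C.carrier)) : rClassMap f d = rClassMap g d := by
    obtain ⟨x, rfl⟩ := Quotient.exists_rep d
    exact (rClass_coneHom f x).symm.trans (h ▸ rClass_coneHom g x)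
  exact CCMorphism.ext (Functor.hext hobj fun _ _ => hmap)
    (OrderHom.ext _ _ (funext fun d => Subtype.ext (hclass d.1)))

end NormalCat

/-! ### The CC-morphism of a homomorphism -/

section MulHom

variable {C D : Type u} [SmallCategory C] [NormalCategory C] [SmallCategory D] [NormalCategory D]
  (φ : Cones C →ₙ* Cones D)

/-- The object map of the functor `C ⥤ D` induced by a homomorphism of semigroups of cones. -/
noncomputable def homObj (c : C) : D := (φ (unitCone c)).vertex

theorem vertex_map (x : Cones C) : (φ x).vertex = homObj φ x.vertex := by
  have vertex_le {x y : Cones C} (h : IsSubobject x.vertex y.vertex) :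
      IsSubobject (φ x).vertex (φ y).vertex :=
    Cones.mem_leftIdeal_iff.1 (map_mem_leftIdeal φ (Cones.mem_leftIdeal_iff.2 h))
  exact (vertex_le (x := x) (y := unitCone x.vertex) (.refl _)).antisymm
    (vertex_le (x := unitCone x.vertex) (y := x) (.refl _))

theorem unitCone_homObj_mul_map (c : C) :
    unitCone (homObj φ c) * φ (unitCone c) = unitCone (homObj φ c) :=
  (Cones.mul_eq_left_iff ((isIdempotentElem_unitCone c).map φ)).2 (.refl _)

theorem map_mul_unitCone_homObj {x : Cones C} {c : C} (h : x * unitCone c = x) :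
    φ x * unitCone (homObj φ c) = φ x := by
  rw [mul_unitCone_eq_left_iff, ← h, map_mul]
  exact Cones.isSubobject_vertex_mul _ _

theorem exists_homMap {c d : C} (f : c ⟶ d) :
    ∃ g : homObj φ c ⟶ homObj φ d, ofHom g = unitCone (homObj φ c) * φ (ofHom f) :=
  exists_ofHom_eq (by rw [← mul_assoc, isIdempotentElem_unitCone])
    (by rw [mul_assoc, map_mul_unitCone_homObj φ (ofHom_mul_unitCone f)])

/-- The morphism map of the functor `C ⥤ D` induced by a homomorphism of semigroups of cones. -/
noncomputable def homMap {c d : C} (f : c ⟶ d) : homObj φ c ⟶ homObj φ d :=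
  (exists_homMap φ f).choose

theorem ofHom_homMap {c d : C} (f : c ⟶ d) :
    ofHom (homMap φ f) = unitCone (homObj φ c) * φ (ofHom f) :=
  (exists_homMap φ f).choose_spec

/-- The functor `C ⥤ D` induced by a homomorphism of semigroups of cones. -/
noncomputable def homFunctor : C ⥤ D where
  obj := homObj φ
  map := homMap φ
  map_id c := ofHom_injective <| by
    rw [ofHom_homMap, ofHom_id, ofHom_id, unitCone_homObj_mul_map]
  map_comp f g := ofHom_injective <| by
    rw [ofHom_comp, ofHom_homMap, ofHom_homMap, ofHom_homMap, ofHom_comp, map_mul, ← mul_assoc,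
      ← mul_assoc, mul_assoc _ (φ (ofHom f)) (unitCone _),
      map_mul_unitCone_homObj φ (ofHom_mul_unitCone f)]

theorem homMap_incl {a b : C} {j : a ⟶ b} (hj : incl j) : incl (homMap φ j) := by
  have hab : unitCone a * unitCone b = unitCone a := mul_unitCone_eq_left_iff.2 ⟨j, hj⟩
  obtain ⟨k, hk⟩ : IsSubobject (homObj φ a) (homObj φ b) :=
    mul_unitCone_eq_left_iff.1 (map_mul_unitCone_homObj φ hab)
  have hjk : homMap φ j = k := ofHom_injective <| by
    rw [ofHom_homMap, ofHom_of_incl hj, ofHom_of_incl hk, unitCone_homObj_mul_map]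
  exact hjk ▸ hk

/-- The map of R-classes induced by a homomorphism of semigroups of cones. -/
noncomputable def homRClass : RClass (Cones C) →o RClass (Cones D) where
  toFun := Quotient.map φ fun _ _ h => ⟨h.1.map φ, h.2.map φ⟩
  monotone' := by
    rintro ⟨x⟩ ⟨y⟩ h
    exact RightLE.map φ h

theorem exists_map_eq_mk {z : C} (γ : ConeAt C z) :
    ∃ δ : ConeAt D (homObj φ z), φ ⟨z, γ⟩ = ⟨_, δ⟩ ∧
      ∀ c, δ.app (homObj φ c) = homMap φ (γ.app c) := by
  obtain ⟨δ, hδ⟩ := (φ ⟨z, γ⟩).exists_eq_mk (vertex_map φ ⟨z, γ⟩)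
  refine ⟨δ, hδ, fun c => ofHom_injective ?_⟩
  calc ofHom (δ.app (homObj φ c))
    _ = unitCone (homObj φ c) * φ ⟨z, γ⟩ := by rw [hδ, unitCone_mul]
    _ = unitCone (homObj φ c) * φ (unitCone c * ⟨z, γ⟩) := by
      rw [map_mul, ← mul_assoc, unitCone_homObj_mul_map]
    _ = ofHom (homMap φ (γ.app c)) := (ofHom_homMap φ (γ.app c)).symm

end MulHom

namespace NormalCat

variable {C D : NormalCat.{u}}

/-- The CC-morphism induced by a homomorphism of semigroups of cones. -/
noncomputable def ofMulHom (φ : Cones C.carrier →ₙ* Cones D.carrier) : C ⟶ D :=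
  homMk (homFunctor φ) (homRClass φ) (fun _ => homMap_incl φ) fun γ => by
    obtain ⟨δ, hδ, happ⟩ := exists_map_eq_mk φ γ
    exact ⟨δ, congrArg rClass hδ.symm, happ⟩

theorem coneHom_ofMulHom (φ : Cones C.carrier →ₙ* Cones D.carrier) :
    coneHom (ofMulHom φ) = φ := by
  ext ⟨z, γ⟩ : 1
  obtain ⟨δ, hδ, happ⟩ := exists_map_eq_mk φ γ
  rw [hδ]
  exact congrArg (Cones.mk _)
    (coneMap_unique (ofMulHom φ) (congrArg rClass hδ.symm) happ)

end NormalCat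

/-! ### The equivalence -/

/-- The functor from normal categories to semigroups that sends a normal category to its semigroup
of cones. -/
noncomputable def coneFunctor : NormalCat.{u} ⥤ Semigrp.{u} where
  obj C := Semigrp.of (Cones C.carrier)
  map f := Semigrp.ofHom (NormalCat.coneHom f)
  map_id C := congrArg Semigrp.ofHom (NormalCat.coneHom_id C)
  map_comp f g := congrArg Semigrp.ofHom (NormalCat.coneHom_comp f g)

instance : coneFunctor.{u}.Faithful where
  map_injective h := NormalCat.coneHom_injective (congrArg Semigrp.Hom.hom h)

instance : coneFunctor.{u}.Full where
  map_surjective φ := ⟨NormalCat.ofMulHom φ.hom,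
    Semigrp.hom_ext (NormalCat.coneHom_ofMulHom φ.hom)⟩

theorem isTotallyLeftReductive_coneFunctor_obj (C : NormalCat.{u}) :
    IsTotallyLeftReductive (coneFunctor.obj C) :=
  isTotallyLeftReductive_cones C.carrier

/-- The functor `coneFunctor` with values in totally left reductive semigroups. -/
noncomputable def coneFunctorTLR : NormalCat.{u} ⥤ TotallyLeftReductiveSemigrp.{u} :=
  IsTotallyLeftReductive.lift coneFunctor isTotallyLeftReductive_coneFunctor_obj

instance : coneFunctorTLR.{u}.Faithful :=
  inferInstanceAs (IsTotallyLeftReductive.lift coneFunctor _).Faithful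

instance : coneFunctorTLR.{u}.Full :=
  inferInstanceAs (IsTotallyLeftReductive.lift coneFunctor _).Full

instance : coneFunctorTLR.{u}.EssSurj where
  mem_essImage S := by
    obtain ⟨hS, ⟨e⟩⟩ := S.property
    exact ⟨⟨LeftCat S.obj⟩, ⟨IsTotallyLeftReductive.isoMk e.symm.toSemigrpIso⟩⟩

instance : coneFunctorTLR.{u}.IsEquivalence where

end ConnCat

theorem theorem7 :
    Nonempty (ConnCat.NormalCat.{u} ≌ ConnCat.TotallyLeftReductiveSemigrp.{u}) :=
  ⟨ConnCat.coneFunctorTLR.asEquivalence⟩
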